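/- **Setting.** Let $\{f_\theta\}$ be a family of probability densities with respect to a $\sigma$-finite measure on a measurable space, and for $k=1,\dots,K$ let $f_{\theta_{k,0}}$ and $f_{\theta_{k,1}}$ be the pre- and post-change densities of stream $k$. Under $P_\infty$ (no change ever occurs) the observations $X_{k,t}$ ($1\le k\le K$, $t\ge1$) are mutually independent and $X_{k,t}$ has density $f_{\theta_{k,0}}$. At each time $t\ge 1$ a set $S_t$ of exactly $q$ streams is observed, and with $R_{k,0}=0$, $L_{k,0}=1$ one puts $$R_{k,t}=(R_{k,t-1}+1)\Lambda_{k,t},\qquad L_{k,t}=L_{k,t-1}\Lambda_{k,t},\qquad \Lambda_{k,t}=\begin{cases} f_{\theta_{k,1}}(X_{k,t})/f_{\theta_{k,0}}(X_{k,t}), & k\in S_t,\\ 1,& k\notin S_t.\end{cases}$$ The initial layout $S_1$ is an arbitrary random set of $q$ streams. For $t\ge1$, fresh values $\tilde R_{k,t}$ are drawn independently from prior distributions $G_k$ on $\mathbb R$ (for instance one common $G$), independently of the past and of the observations at time $t$, and $S_{t+1}$ consists of $q$ streams with the largest values of $R^*_{k,t}=R_{k,t}+L_{k,t}\tilde R_{k,t}$.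 Layouts (in particular the choice of $S_1$ and the breaking of ties) do not anticipate the future: for some filtration $(\mathcal F_t)_{t\ge 0}$ to which the $X_{k,t}$ and $\tilde R_{k,t}$ are adapted, $S_{t+1}$ is $\mathcal F_t$-measurable and $(X_{k,t+1},\tilde R_{k,t+1})_{k\le K}$ is independent of $\mathcal F_t$. Let $R_{(1),t}\ge\dots\ge R_{(K),t}$ be the decreasing order of $R_{1,t},\dots,R_{K,t}$, let $1\le r\le K$, and for real $A$ let $$T=T_A=\inf\Big\{t\ge1:\ \sum_{k=1}^{r}R_{(k),t}\ge A\Big\},\qquad \inf\emptyset=\infty .$$ **Theorem 2 (Average run length to false alarm).** (i) $\mathbb E_\infty(T_A)\ge A/K$ for every $A$. (ii) If the Kullback–Leibler divergence of $f_{\theta_{k,1}}$ from $f_{\theta_{k,0}}$, that is $\int f_{\theta_{k,1}}\log(f_{\theta_{k,1}}/f_{\theta_{k,0}})$ (understood as $+\infty$ when $f_{\theta_{k,1}}$ is not absolutely continuous with respect to $f_{\theta_{k,0}}$), is finite for at least one stream $k$, then $\mathbb E_\infty(T_A)=O(A)$ as $A\to\infty$: there is a finite constant $C$ with $\mathbb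 E_\infty(T_A)\le C A$ for all sufficiently large $A$. -/

import Mathlib

open MeasureTheory ProbabilityTheory Filter InformationTheory
open scoped ENNReal NNReal

namespace TSSRP

/-- `g` is a probability density with respect to the reference measure `m`. -/
structure IsDensity {𝒳 : Type*} [MeasurableSpace 𝒳] (m : Measure 𝒳) (g : 𝒳 → ℝ) : Prop where
  measurable : Measurable g
  nonneg : ∀ x, 0 ≤ g x
  lintegral_eq_one : ∫⁻ x, ENNReal.ofReal (g x) ∂m = 1

/-- The probability measure with density `g` with respect to `m`. -/
noncomputable def law {𝒳 : Type*} [MeasurableSpace 𝒳] (m : Measure 𝒳) (g : 𝒳 → ℝ) : Measure 𝒳 :=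
  m.withDensity fun x => ENNReal.ofReal (g x)

/-- The local statistic `R_{k,t}` for the likelihood ratios `lr k`, the observations `X k t`
and the sensor layouts `S t` (only the times `t ≥ 1` of `X` and `S` are used). -/
noncomputable def R {K : ℕ} {𝒳 Ω : Type*} (lr : Fin K → 𝒳 → ℝ) (X : Fin K → ℕ → Ω → 𝒳)
    (S : ℕ → Ω → Finset (Fin K)) (k : Fin K) : ℕ → Ω → ℝ
  | 0, _ => 0
  | t + 1, ω =>
    if k ∈ S (t + 1) ω then (R lr X S k t ω + 1) * lr k (X k (t + 1) ω)
    else R lr X S k t ω + 1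

/-- The local likelihood ratio statistic `L_{k,t}`. -/
noncomputable def L {K : ℕ} {𝒳 Ω : Type*} (lr : Fin K → 𝒳 → ℝ) (X : Fin K → ℕ → Ω → 𝒳)
    (S : ℕ → Ω → Finset (Fin K)) (k : Fin K) : ℕ → Ω → ℝ
  | 0, _ => 1
  | t + 1, ω =>
    if k ∈ S (t + 1) ω then L lr X S k t ω * lr k (X k (t + 1) ω)
    else L lr X S k t ω

/-- The sampling statistic `R*_{k,t} = R_{k,t} + L_{k,t} R̃_{k,t}`, with `R̃ = Z`. -/
noncomputable def Rstar {K : ℕ} {𝒳 Ω : Type*} (lr : Fin K → 𝒳 → ℝ) (X : Fin K → ℕ → Ω → 𝒳)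
    (Z : Fin K → ℕ → Ω → ℝ) (S : ℕ → Ω → Finset (Fin K)) (k : Fin K) (t : ℕ) (ω : Ω) : ℝ :=
  R lr X S k t ω + L lr X S k t ω * Z k t ω

/-- The decreasing rearrangement of `v`: `orderStat v j` is the `(j+1)`-st largest entry. -/
noncomputable def orderStat {K : ℕ} (v : Fin K → ℝ) (j : Fin K) : ℝ :=
  v (Tuple.sort (fun i => -v i) j)

/-- The sum of the `r` largest entries of `v`. -/
noncomputable def topSum {K : ℕ} (r : ℕ) (v : Fin K → ℝ) : ℝ :=
  ∑ j : Fin K with j.val < r, orderStat v j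

/-- The stopping time `T = inf {t ≥ 1 : R_{(1),t} + ... + R_{(r),t} ≥ A}`, with `inf ∅ = ∞`. -/
noncomputable def T {K : ℕ} {𝒳 Ω : Type*} (lr : Fin K → 𝒳 → ℝ) (X : Fin K → ℕ → Ω → 𝒳)
    (S : ℕ → Ω → Finset (Fin K)) (r : ℕ) (A : ℝ) (ω : Ω) : ℕ∞ :=
  sInf ((fun t : ℕ => (t : ℕ∞)) '' {t | 1 ≤ t ∧ A ≤ topSum r fun k => R lr X S k t ω})

/-- The data and the random draws of the algorithm when no change ever occurs. At every time
`t + 1` the observations `X k (t + 1)`, with laws `μ k`, and the draws `Z k (t + 1)` from the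
priors `G k` are mutually independent and jointly independent of the past `ℱ t`. -/
structure IsInControl {K : ℕ} {𝒳 Ω : Type*} [MeasurableSpace 𝒳] {mΩ : MeasurableSpace Ω}
    (P : Measure Ω) (ℱ : Filtration ℕ mΩ) (μ : Fin K → Measure 𝒳) (G : Fin K → Measure ℝ)
    (X : Fin K → ℕ → Ω → 𝒳) (Z : Fin K → ℕ → Ω → ℝ) : Prop where
  measurable_obs : ∀ k t, Measurable[ℱ (t + 1)] (X k (t + 1))
  measurable_draw : ∀ k t, Measurable[ℱ (t + 1)] (Z k (t + 1))
  law_obs : ∀ k t, P.map (X k (t + 1)) = μ k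
  law_draw : ∀ k t, P.map (Z k (t + 1)) = G k
  indep_obs : ∀ t, iIndepFun (fun k => X k (t + 1)) P
  indep_draw : ∀ t, iIndepFun (fun k => Z k (t + 1)) P
  indep_obs_draw : ∀ t, IndepFun (fun ω k => X k (t + 1) ω) (fun ω k => Z k (t + 1) ω) P
  indep_past : ∀ t, Indep
    (MeasurableSpace.comap (fun ω => ((fun k => X k (t + 1) ω), (fun k => Z k (t + 1) ω)))
      inferInstance) (ℱ t) P

/-- `S` is a sequence of sensor layouts produced by the sampling policy: `q` streams are
observed at each time, the layout of time `t + 1` is chosen from the information `ℱ t`, the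
first layout is an arbitrary random one, and from then on the layout of time `t + 1` consists
of `q` streams with the largest values of `R*_{k,t}`; ties may be broken in any way, possibly
at random, that does not anticipate the future. -/
structure IsLayout {K : ℕ} {𝒳 Ω : Type*} {mΩ : MeasurableSpace Ω}
    (ℱ : Filtration ℕ mΩ) (q : ℕ) (lr : Fin K → 𝒳 → ℝ) (X : Fin K → ℕ → Ω → 𝒳)
    (Z : Fin K → ℕ → Ω → ℝ) (S : ℕ → Ω → Finset (Fin K)) : Prop where
  card_eq : ∀ t ω, (S (t + 1) ω).card = q
  predictable : ∀ t k, MeasurableSet[ℱ t] {ω | k ∈ S (t + 1) ω}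
  largest : ∀ t, 1 ≤ t → ∀ ω, ∀ i ∈ S (t + 1) ω, ∀ j ∉ S (t + 1) ω,
    Rstar lr X Z S j t ω ≤ Rstar lr X Z S i t ω

end TSSRP

/-!
Part (i): under `P` the process `∑ k, R k t - K * t` is a supermartingale, since each step adds
`1` to `R k` and then multiplies by a factor of mean at most one. The sum of the `r` largest
entries is at most the full sum, so optional stopping gives `A ≤ K * 𝔼 T`.

Part (ii): let `k` be a stream with finite divergence. The sum of the `r` largest entries is at
least `R k`, so it suffices to bound the time at which `R k` reaches `A`. Consider potentials
`V y = y * φ (log (y / B))` with `B = A + 1`. The factor `y` tilts the pre-change law into the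
post-change law, under which the log-likelihood ratio has positive mean, the divergence. This
drift leaves room to take for `φ` a convex ramp, capped and then cut off to `0` above some level,
such that averaging over an observation does not decrease `V`, while the `+ 1` in the recursion
increases `V` by at least one, as long as `R k + 1 ≤ B`. Since `V` is at most a constant times
`B`, optional stopping bounds the mean hitting time by `O(A)`. When the divergence vanishes the
ratio is almost surely one and a capped linear potential does.
-/

namespace TSSRP

section DriftWeight

variable {𝒳 : Type*} [MeasurableSpace 𝒳] {μ : Measure 𝒳} {ξ : 𝒳 → ℝ} {κ a b : ℝ}

/-- The stop-loss transform `u ↦ E (ξ - u)⁺` of a real random variable `ξ`. -/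
noncomputable def stopLoss (μ : Measure 𝒳) (ξ : 𝒳 → ℝ) (u : ℝ) : ℝ :=
  ∫ x, max (ξ x - u) 0 ∂μ

theorem stopLoss_nonneg (μ : Measure 𝒳) (ξ : 𝒳 → ℝ) (u : ℝ) : 0 ≤ stopLoss μ ξ u :=
  integral_nonneg fun _ => le_max_right _ _

theorem integrable_max_sub_zero [IsFiniteMeasure μ] (hξ : Integrable ξ μ) (u : ℝ) :
    Integrable (fun x => max (ξ x - u) 0) μ :=
  (hξ.sub (integrable_const u)).pos_part

theorem stopLoss_antitone [IsFiniteMeasure μ] (hξ : Integrable ξ μ) : Antitone (stopLoss μ ξ) :=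
  fun _ _ huv => integral_mono (integrable_max_sub_zero hξ _) (integrable_max_sub_zero hξ _)
    fun _ => max_le_max (sub_le_sub_left huv _) le_rfl

theorem tendsto_stopLoss_atTop (hξ : Integrable ξ μ) :
    Tendsto (stopLoss μ ξ) atTop (nhds 0) := by
  rw [← integral_zero 𝒳 ℝ (μ := μ)]
  refine tendsto_integral_filter_of_dominated_convergence (fun x => |ξ x|)
    (Eventually.of_forall fun u =>
      (hξ.aestronglyMeasurable.sub aestronglyMeasurable_const).sup aestronglyMeasurable_const)
    ?_ hξ.abs (Eventually.of_forall fun x => ?_)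
  · filter_upwards [eventually_ge_atTop 0] with u hu
    refine Eventually.of_forall fun x => ?_
    rw [Real.norm_of_nonneg (le_max_right _ _)]
    exact max_le (by linarith [le_abs_self (ξ x)]) (abs_nonneg _)
  · refine tendsto_const_nhds.congr' ?_
    filter_upwards [eventually_ge_atTop (ξ x)] with u hu
    exact (max_eq_right (sub_nonpos.2 hu)).symm

theorem integral_min_eq_integral_sub_stopLoss [IsFiniteMeasure μ] (hξ : Integrable ξ μ) (b : ℝ) :
    ∫ x, min (ξ x) b ∂μ = ∫ x, ξ x ∂μ - stopLoss μ ξ b := by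
  rw [stopLoss, ← integral_sub hξ (integrable_max_sub_zero hξ b)]
  congr with x
  rcases le_total (ξ x) b with h | h
  · rw [min_eq_left h, max_eq_right (sub_nonpos.2 h), sub_zero]
  · rw [min_eq_right h, max_eq_left (sub_nonneg.2 h), sub_sub_cancel]

-- The stop-loss transform is convex, and `-P (u < ξ)` is a subgradient at `u`.
theorem stopLoss_add_mul_le_stopLoss_sub [IsFiniteMeasure μ] (hm : Measurable ξ)
    (hξ : Integrable ξ μ) (u h : ℝ) :
    stopLoss μ ξ u + h * μ.real {x | u < ξ x} ≤ stopLoss μ ξ (u - h) := by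
  have hE : MeasurableSet {x | u < ξ x} := measurableSet_lt measurable_const hm
  have hind : Integrable ({x | u < ξ x}.indicator fun _ => h) μ :=
    (integrable_const h).indicator hE
  calc stopLoss μ ξ u + h * μ.real {x | u < ξ x}
      = ∫ x, (max (ξ x - u) 0 + {x | u < ξ x}.indicator (fun _ => h) x) ∂μ := by
        rw [integral_add (integrable_max_sub_zero hξ u) hind, integral_indicator_const _ hE,
          smul_eq_mul, mul_comm, stopLoss]
    _ ≤ stopLoss μ ξ (u - h) := by
        refine integral_mono ((integrable_max_sub_zero hξ u).add hind)
          (integrable_max_sub_zero hξ _) fun x => ?_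
        by_cases hx : u < ξ x
        · rw [Set.indicator_of_mem (show x ∈ {x | u < ξ x} from hx), max_eq_left (by linarith)]
          exact le_max_of_le_left (by linarith)
        · rw [Set.indicator_of_notMem (show x ∉ {x | u < ξ x} from hx), add_zero,
            max_eq_right (by linarith)]
          exact le_max_right _ _

/-- A nonnegative weight, between `1` and `2` and nondecreasing on the negative half-line and
vanishing above the level `a`, which is subharmonic at nonpositive levels for the random walk
with increments distributed as `ξ`. It serves as the logarithmic profile of an `IsPotential`. -/
structure IsDriftWeight (μ : Measure 𝒳) (ξ : 𝒳 → ℝ) (a : ℝ) (φ : ℝ → ℝ) : Prop where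
  measurable : Measurable φ
  nonneg : ∀ s, 0 ≤ φ s
  le_two : ∀ s, φ s ≤ 2
  eq_zero_of_lt : ∀ s, a < s → φ s = 0
  one_le : ∀ s ≤ 0, 1 ≤ φ s
  monotoneOn : MonotoneOn φ (Set.Iic 0)
  le_integral : ∀ s ≤ 0, φ s ≤ ∫ x, φ (s + ξ x) ∂μ

/-- The convex function `s ↦ 1 + κ E (s + ξ - a)⁺`, from which drift weights are cut out. -/
noncomputable def ramp (μ : Measure 𝒳) (ξ : 𝒳 → ℝ) (κ a s : ℝ) : ℝ :=
  1 + κ * stopLoss μ ξ (a - s)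

theorem one_le_ramp (hκ : 0 ≤ κ) (s : ℝ) : 1 ≤ ramp μ ξ κ a s :=
  le_add_of_nonneg_right (mul_nonneg hκ (stopLoss_nonneg μ ξ _))

theorem ramp_monotone [IsFiniteMeasure μ] (hξ : Integrable ξ μ) (hκ : 0 ≤ κ) :
    Monotone (ramp μ ξ κ a) := fun _ _ hst =>
  add_le_add_right (mul_le_mul_of_nonneg_left
    (stopLoss_antitone hξ (sub_le_sub_left hst a)) hκ) 1

theorem ramp_add_mul_le_ramp_add [IsFiniteMeasure μ] (hm : Measurable ξ) (hξ : Integrable ξ μ)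
    (hκ : 0 ≤ κ) (s h : ℝ) :
    ramp μ ξ κ a s + h * (κ * μ.real {x | a - s < ξ x}) ≤ ramp μ ξ κ a (s + h) := by
  have hsub := mul_le_mul_of_nonneg_left (stopLoss_add_mul_le_stopLoss_sub hm hξ (a - s) h) hκ
  rw [ramp, ramp, ← sub_sub]
  linarith

/-- The ramp capped at `2` and cut off above the level `a`. -/
noncomputable def cutRamp (μ : Measure 𝒳) (ξ : 𝒳 → ℝ) (κ a : ℝ) : ℝ → ℝ :=
  (Set.Iic a).indicator fun s => min (ramp μ ξ κ a s) 2

theorem cutRamp_of_le {s : ℝ} (hs : s ≤ a) : cutRamp μ ξ κ a s = min (ramp μ ξ κ a s) 2 :=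
  Set.indicator_of_mem (Set.mem_Iic.2 hs) _

theorem cutRamp_of_lt {s : ℝ} (hs : a < s) : cutRamp μ ξ κ a s = 0 :=
  Set.indicator_of_notMem (by simpa using hs) _

theorem cutRamp_nonneg (hκ : 0 ≤ κ) (s : ℝ) : 0 ≤ cutRamp μ ξ κ a s :=
  Set.indicator_nonneg
    (fun s _ => le_min (zero_le_one.trans (one_le_ramp hκ s)) zero_le_two) s

theorem cutRamp_le_two (s : ℝ) : cutRamp μ ξ κ a s ≤ 2 :=
  Set.indicator_le' (fun _ _ => min_le_right _ _) (fun _ _ => zero_le_two) s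

theorem cutRamp_le_ramp (hκ : 0 ≤ κ) (s : ℝ) : cutRamp μ ξ κ a s ≤ ramp μ ξ κ a s :=
  Set.indicator_le' (fun _ _ => min_le_left _ _)
    (fun s _ => zero_le_one.trans (one_le_ramp hκ s)) s

theorem measurable_cutRamp [IsFiniteMeasure μ] (hξ : Integrable ξ μ) (hκ : 0 ≤ κ) :
    Measurable (cutRamp μ ξ κ a) :=
  ((ramp_monotone hξ hκ).measurable.min measurable_const).indicator measurableSet_Iic

theorem ramp_add_sub_indicator_le_cutRamp [IsFiniteMeasure μ] (hm : Measurable ξ)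
    (hξ : Integrable ξ μ) (hκ : 0 ≤ κ) (hb : ramp μ ξ κ a b ≤ 2) {s : ℝ} (hs : s ≤ 0) (x : 𝒳) :
    ramp μ ξ κ a s + min (ξ x) b * (κ * μ.real {x | a - s < ξ x})
      - {x | a - s < ξ x}.indicator (fun _ => 2) x ≤ cutRamp μ ξ κ a (s + ξ x) := by
  have hmono := ramp_monotone (a := a) hξ hκ
  have hsub := ramp_add_mul_le_ramp_add (a := a) hm hξ hκ s (min (ξ x) b)
  have hle_two : ramp μ ξ κ a (s + min (ξ x) b) ≤ 2 :=
    (hmono (by linarith [min_le_right (ξ x) b])).trans hb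
  by_cases hx : a - s < ξ x
  · rw [cutRamp_of_lt (by linarith), Set.indicator_of_mem (show x ∈ {x | a - s < ξ x} from hx)]
    linarith
  · rw [cutRamp_of_le (by linarith),
      Set.indicator_of_notMem (show x ∉ {x | a - s < ξ x} from hx), sub_zero]
    exact hsub.trans (le_min (hmono (by linarith [min_le_left (ξ x) b])) hle_two)

theorem ramp_le_integral_cutRamp [IsProbabilityMeasure μ] (hm : Measurable ξ)
    (hξ : Integrable ξ μ) (hκ : 0 ≤ κ) (hκb : κ * ∫ x, min (ξ x) b ∂μ = 2)
    (hb : ramp μ ξ κ a b ≤ 2) {s : ℝ} (hs : s ≤ 0) :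
    ramp μ ξ κ a s ≤ ∫ x, cutRamp μ ξ κ a (s + ξ x) ∂μ := by
  have hE : MeasurableSet {x | a - s < ξ x} := measurableSet_lt measurable_const hm
  have hmin : Integrable (fun x => min (ξ x) b * (κ * μ.real {x | a - s < ξ x})) μ :=
    (hξ.inf (integrable_const b)).mul_const _
  have hind : Integrable ({x | a - s < ξ x}.indicator fun _ => (2 : ℝ)) μ :=
    (integrable_const 2).indicator hE
  have hlin : Integrable
      (fun x => ramp μ ξ κ a s + min (ξ x) b * (κ * μ.real {x | a - s < ξ x})) μ :=
    (integrable_const _).add hmin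
  have hcut : Integrable (fun x => cutRamp μ ξ κ a (s + ξ x)) μ :=
    Integrable.of_bound
      ((measurable_cutRamp hξ hκ).comp (hm.const_add s)).aestronglyMeasurable 2
      (Eventually.of_forall fun x => by
        rw [Real.norm_of_nonneg (cutRamp_nonneg hκ _)]
        exact cutRamp_le_two _)
  calc ramp μ ξ κ a s
      = ∫ x, (ramp μ ξ κ a s + min (ξ x) b * (κ * μ.real {x | a - s < ξ x})
          - {x | a - s < ξ x}.indicator (fun _ => 2) x) ∂μ := by
        rw [integral_sub hlin hind, integral_add (integrable_const _) hmin, integral_mul_const,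
          integral_indicator_const _ hE, integral_const, probReal_univ, one_smul, smul_eq_mul]
        linear_combination (-μ.real {x | a - s < ξ x}) * hκb
    _ ≤ _ := integral_mono (hlin.sub hind) hcut
        (ramp_add_sub_indicator_le_cutRamp hm hξ hκ hb hs)

theorem isDriftWeight_cutRamp [IsProbabilityMeasure μ] (hm : Measurable ξ) (hξ : Integrable ξ μ)
    (ha : 0 ≤ a) (hκ : 0 ≤ κ) (hκb : κ * ∫ x, min (ξ x) b ∂μ = 2) (hb : ramp μ ξ κ a b ≤ 2) :
    IsDriftWeight μ ξ a (cutRamp μ ξ κ a) where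
  measurable := measurable_cutRamp hξ hκ
  nonneg := cutRamp_nonneg hκ
  le_two := cutRamp_le_two
  eq_zero_of_lt _ := cutRamp_of_lt
  one_le s hs := by
    rw [cutRamp_of_le (hs.trans ha)]
    exact le_min (one_le_ramp hκ s) one_le_two
  monotoneOn s hs t ht hst := by
    rw [cutRamp_of_le (le_trans hs ha), cutRamp_of_le (le_trans ht ha)]
    exact min_le_min_right 2 (ramp_monotone hξ hκ hst)
  le_integral s hs := (cutRamp_le_ramp hκ s).trans (ramp_le_integral_cutRamp hm hξ hκ hκb hb hs)

theorem exists_isDriftWeight [IsProbabilityMeasure μ] (hm : Measurable ξ) (hξ : Integrable ξ μ)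
    (hpos : 0 < ∫ x, ξ x ∂μ) : ∃ a φ, IsDriftWeight μ ξ a φ := by
  have hlim := tendsto_stopLoss_atTop hξ
  obtain ⟨b, hb⟩ := (hlim.eventually (gt_mem_nhds hpos)).exists
  have hIpos : 0 < ∫ x, min (ξ x) b ∂μ := by
    rw [integral_min_eq_integral_sub_stopLoss hξ]
    exact sub_pos.2 hb
  obtain ⟨u, hu, hub⟩ := ((hlim.eventually (ge_mem_nhds (half_pos hIpos))).and
    (eventually_ge_atTop (-b))).exists
  refine ⟨u + b, cutRamp μ ξ (2 / ∫ x, min (ξ x) b ∂μ) (u + b), isDriftWeight_cutRamp (b := b) hm hξ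
    (by linarith) (by positivity) (div_mul_cancel₀ _ hIpos.ne') ?_⟩
  have hle_one : 2 / (∫ x, min (ξ x) b ∂μ) * stopLoss μ ξ u ≤ 1 := by
    rw [div_mul_eq_mul_div, div_le_one hIpos]
    linarith
  rw [ramp, add_sub_cancel_right]
  linarith

end DriftWeight

section Potential

variable {𝒳 : Type*} [MeasurableSpace 𝒳] {μ₀ μ₁ : Measure 𝒳} {l : 𝒳 → ℝ} {a B : ℝ} {φ : ℝ → ℝ}

/-- A bounded potential for the chain that moves from `x` either to `x + 1` or to `(x + 1) * l`,
where `l` is a likelihood ratio with respect to `μ₀` evaluated at a fresh observation: as long as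
`x + 1 ≤ B`, either move increases `V` by at least `1` on average. -/
structure IsPotential (μ₀ : Measure 𝒳) (l : 𝒳 → ℝ) (B : ℝ) (M : ℝ≥0∞) (V : ℝ → ℝ≥0∞) :
    Prop where
  measurable : Measurable V
  le_bound : ∀ x, V x ≤ M
  add_one_le : ∀ x, 0 ≤ x → x + 1 ≤ B → V x + 1 ≤ V (x + 1)
  le_lintegral : ∀ y, 0 < y → y ≤ B → V y ≤ ∫⁻ x, V (y * l x) ∂μ₀

theorem isPotential_of_ae_eq_one [IsProbabilityMeasure μ₀] (hl : ∀ᵐ x ∂μ₀, l x = 1) (B : ℝ) :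
    IsPotential μ₀ l B (ENNReal.ofReal B) fun x => ENNReal.ofReal (min x B) where
  measurable := by fun_prop
  le_bound x := ENNReal.ofReal_le_ofReal (min_le_right _ _)
  add_one_le x hx hxB := by
    rw [min_eq_left hxB, min_eq_left (by linarith), ENNReal.ofReal_add hx zero_le_one,
      ENNReal.ofReal_one]
  le_lintegral y _ _ := by
    have hconst : ∀ᵐ x ∂μ₀, ENNReal.ofReal (min (y * l x) B) = ENNReal.ofReal (min y B) :=
      hl.mono fun x hx => by rw [hx, mul_one]
    rw [lintegral_congr_ae hconst, lintegral_const, measure_univ, mul_one]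

/-- The function `y ↦ y φ(log (y / B))`, the potential with logarithmic profile `φ`. The factor
`y` tilts the law of the observations from `μ₀` to the law with density `l`. -/
noncomputable def logPotential (φ : ℝ → ℝ) (B y : ℝ) : ℝ≥0∞ :=
  ENNReal.ofReal (y * φ (Real.log (y / B)))

theorem measurable_logPotential (hφ : Measurable φ) (B : ℝ) : Measurable (logPotential φ B) :=
  (measurable_id.mul (hφ.comp (measurable_id.div_const B).log)).ennreal_ofReal

theorem logPotential_mul {y c : ℝ} (hy : 0 < y) (hc : 0 ≤ c) (hB : 0 < B) :
    logPotential φ B (y * c) = ENNReal.ofReal y *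
      (ENNReal.ofReal c * ENNReal.ofReal (φ (Real.log (y / B) + Real.log c))) := by
  rcases hc.eq_or_lt with rfl | hc
  · simp [logPotential]
  · rw [logPotential, mul_div_right_comm, Real.log_mul (by positivity) hc.ne', mul_assoc,
      ENNReal.ofReal_mul hy.le, ENNReal.ofReal_mul hc.le]

namespace IsDriftWeight

theorem logPotential_le {ξ : 𝒳 → ℝ} (h : IsDriftWeight μ₁ ξ a φ) (hB : 0 < B) (y : ℝ) :
    logPotential φ B y ≤ ENNReal.ofReal (2 * Real.exp a * B) := by
  refine ENNReal.ofReal_le_ofReal ?_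
  rcases le_or_gt y 0 with hy | hy
  · exact (mul_nonpos_of_nonpos_of_nonneg hy (h.nonneg _)).trans (by positivity)
  rcases le_or_gt (Real.log (y / B)) a with hya | hya
  · rw [Real.log_le_iff_le_exp (div_pos hy hB), div_le_iff₀ hB] at hya
    calc y * φ (Real.log (y / B)) ≤ y * 2 := mul_le_mul_of_nonneg_left (h.le_two _) hy.le
      _ ≤ 2 * Real.exp a * B := by linarith
  · rw [h.eq_zero_of_lt _ hya, mul_zero]
    positivity

theorem logPotential_add_one_le {ξ : 𝒳 → ℝ} (h : IsDriftWeight μ₁ ξ a φ) (hB : 0 < B) {x : ℝ}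
    (hx : 0 ≤ x) (hxB : x + 1 ≤ B) : logPotential φ B x + 1 ≤ logPotential φ B (x + 1) := by
  have hlog : Real.log ((x + 1) / B) ≤ 0 :=
    Real.log_nonpos (by positivity) ((div_le_one hB).2 hxB)
  have hmono : x * φ (Real.log (x / B)) ≤ x * φ (Real.log ((x + 1) / B)) := by
    rcases hx.eq_or_lt with rfl | hx
    · rw [zero_mul, zero_mul]
    · have hle : Real.log (x / B) ≤ Real.log ((x + 1) / B) :=
        Real.log_le_log (by positivity) (by gcongr; linarith)
      exact mul_le_mul_of_nonneg_left (h.monotoneOn (hle.trans hlog) hlog hle) hx.le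
  rw [logPotential, logPotential, ← ENNReal.ofReal_one,
    ← ENNReal.ofReal_add (mul_nonneg hx (h.nonneg _)) zero_le_one]
  exact ENNReal.ofReal_le_ofReal (by linarith [h.one_le _ hlog])

theorem logPotential_le_lintegral [IsFiniteMeasure μ₁] (hl : Measurable l) (hl0 : ∀ x, 0 ≤ l x)
    (hμ : μ₁ = μ₀.withDensity fun x => ENNReal.ofReal (l x))
    (h : IsDriftWeight μ₁ (fun x => Real.log (l x)) a φ) {y : ℝ} (hy : 0 < y) (hyB : y ≤ B) :
    logPotential φ B y ≤ ∫⁻ x, logPotential φ B (y * l x) ∂μ₀ := by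
  have hB : 0 < B := hy.trans_le hyB
  have hlog : Real.log (y / B) ≤ 0 := Real.log_nonpos (by positivity) ((div_le_one hB).2 hyB)
  have hm : Measurable fun x => φ (Real.log (y / B) + Real.log (l x)) :=
    h.measurable.comp (hl.log.const_add _)
  have hint : Integrable (fun x => φ (Real.log (y / B) + Real.log (l x))) μ₁ :=
    Integrable.of_bound hm.aestronglyMeasurable 2 (Eventually.of_forall fun x => by
      rw [Real.norm_of_nonneg (h.nonneg _)]
      exact h.le_two _)
  calc logPotential φ B y
      ≤ ENNReal.ofReal (y * ∫ x, φ (Real.log (y / B) + Real.log (l x)) ∂μ₁) :=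
        ENNReal.ofReal_le_ofReal (mul_le_mul_of_nonneg_left (h.le_integral _ hlog) hy.le)
    _ = ENNReal.ofReal y * ∫⁻ x, ENNReal.ofReal (φ (Real.log (y / B) + Real.log (l x))) ∂μ₁ := by
        rw [ENNReal.ofReal_mul hy.le,
          ofReal_integral_eq_lintegral_ofReal hint (Eventually.of_forall fun x => h.nonneg _)]
    _ = ∫⁻ x, logPotential φ B (y * l x) ∂μ₀ := by
        rw [hμ, lintegral_withDensity_eq_lintegral_mul _ hl.ennreal_ofReal hm.ennreal_ofReal,
          ← lintegral_const_mul _ (hl.ennreal_ofReal.mul hm.ennreal_ofReal)]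
        exact lintegral_congr fun x => (logPotential_mul hy (hl0 x) hB).symm

theorem isPotential [IsFiniteMeasure μ₁] (hl : Measurable l) (hl0 : ∀ x, 0 ≤ l x)
    (hμ : μ₁ = μ₀.withDensity fun x => ENNReal.ofReal (l x))
    (h : IsDriftWeight μ₁ (fun x => Real.log (l x)) a φ) (hB : 0 < B) :
    IsPotential μ₀ l B (ENNReal.ofReal (2 * Real.exp a * B)) (logPotential φ B) where
  measurable := measurable_logPotential h.measurable B
  le_bound := h.logPotential_le hB
  add_one_le _ := h.logPotential_add_one_le hB
  le_lintegral _ := h.logPotential_le_lintegral hl hl0 hμ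

end IsDriftWeight

theorem ae_eq_one_of_withDensity_eq_self [SigmaFinite μ₀] (hl : Measurable l)
    (hμ : μ₀ = μ₀.withDensity fun x => ENNReal.ofReal (l x)) : ∀ᵐ x ∂μ₀, l x = 1 := by
  have hrn := Measure.rnDeriv_withDensity μ₀ hl.ennreal_ofReal
  rw [← hμ] at hrn
  filter_upwards [hrn, Measure.rnDeriv_self μ₀] with x hx hx'
  rwa [hx', eq_comm, ENNReal.ofReal_eq_one] at hx

theorem llr_withDensity_ae_eq_log [SigmaFinite μ₀] (hl : Measurable l) (hl0 : ∀ x, 0 ≤ l x)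
    (hμ : μ₁ = μ₀.withDensity fun x => ENNReal.ofReal (l x)) :
    llr μ₁ μ₀ =ᵐ[μ₁] fun x => Real.log (l x) := by
  subst hμ
  filter_upwards [(withDensity_absolutelyContinuous μ₀ _).ae_le
    (Measure.rnDeriv_withDensity μ₀ hl.ennreal_ofReal)] with x hx
  rw [llr, hx, ENNReal.toReal_ofReal (hl0 x)]

theorem exists_isPotential_of_klDiv_ne_top [IsProbabilityMeasure μ₀] [IsProbabilityMeasure μ₁]
    (hl : Measurable l) (hl0 : ∀ x, 0 ≤ l x)
    (hμ : μ₁ = μ₀.withDensity fun x => ENNReal.ofReal (l x)) (hkl : klDiv μ₁ μ₀ ≠ ∞) :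
    ∃ C : ℝ, 0 ≤ C ∧ ∀ B, 0 < B → ∃ V, IsPotential μ₀ l B (ENNReal.ofReal (C * B)) V := by
  obtain ⟨hac, hint⟩ := klDiv_ne_top_iff.1 hkl
  by_cases heq : μ₁ = μ₀
  · have hone : ∀ᵐ x ∂μ₀, l x = 1 := ae_eq_one_of_withDensity_eq_self hl (heq ▸ hμ)
    exact ⟨1, zero_le_one, fun B _ => ⟨fun x => ENNReal.ofReal (min x B), by
      simpa only [one_mul] using isPotential_of_ae_eq_one hone B⟩⟩
  · have hllr := llr_withDensity_ae_eq_log hl hl0 hμ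
    have hpos : 0 < ∫ x, Real.log (l x) ∂μ₁ := by
      rw [← integral_congr_ae hllr, ← toReal_klDiv_of_measure_eq hac (by simp)]
      exact ENNReal.toReal_pos (fun h => heq (klDiv_eq_zero_iff.1 h)) hkl
    obtain ⟨a, φ, hφ⟩ := exists_isDriftWeight hl.log (hint.congr hllr) hpos
    exact ⟨2 * Real.exp a, by positivity, fun B hB => ⟨_, hφ.isPotential hl hl0 hμ hB⟩⟩

end Potential

section Density

variable {𝒳 : Type*} [MeasurableSpace 𝒳] {m : Measure 𝒳} {g₀ g₁ : 𝒳 → ℝ}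

theorem IsDensity.isProbabilityMeasure_law (h : IsDensity m g₀) :
    IsProbabilityMeasure (law m g₀) :=
  ⟨by rw [law, withDensity_apply _ MeasurableSet.univ, Measure.restrict_univ, h.lintegral_eq_one]⟩

-- The ratio is `0` by convention where `g₀` vanishes, hence the restriction.
theorem IsDensity.law_withDensity_ratio (h₀ : IsDensity m g₀) (h₁ : Measurable g₁) :
    (law m g₀).withDensity (fun x => ENNReal.ofReal (g₁ x / g₀ x)) =
      (law m g₁).restrict {x | g₀ x ≠ 0} := by
  have hE : MeasurableSet {x | g₀ x ≠ 0} := h₀.measurable (measurableSet_singleton 0).compl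
  have hratio : Measurable fun x => ENNReal.ofReal (g₁ x / g₀ x) :=
    (h₁.div h₀.measurable).ennreal_ofReal
  rw [law, law, ← withDensity_mul _ h₀.measurable.ennreal_ofReal hratio,
    restrict_withDensity hE, ← withDensity_indicator hE]
  congr with x
  rw [Pi.mul_apply, ← ENNReal.ofReal_mul (h₀.nonneg x)]
  by_cases hx : g₀ x = 0
  · simp [hx]
  · rw [mul_div_cancel₀ _ hx, Set.indicator_of_mem (show x ∈ {x | g₀ x ≠ 0} from hx)]

theorem IsDensity.lintegral_ratio_le_one (h₀ : IsDensity m g₀) (h₁ : IsDensity m g₁) :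
    ∫⁻ x, ENNReal.ofReal (g₁ x / g₀ x) ∂law m g₀ ≤ 1 := by
  have := h₁.isProbabilityMeasure_law
  rw [← setLIntegral_univ, ← withDensity_apply _ MeasurableSet.univ,
    h₀.law_withDensity_ratio h₁.measurable]
  exact (Measure.restrict_apply_le _ _).trans prob_le_one

theorem IsDensity.law_eq_withDensity_ratio (h₀ : IsDensity m g₀) (h₁ : Measurable g₁)
    (hac : law m g₁ ≪ law m g₀) :
    law m g₁ = (law m g₀).withDensity fun x => ENNReal.ofReal (g₁ x / g₀ x) := by
  have hne : ∀ᵐ x ∂law m g₀, g₀ x ≠ 0 := by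
    rw [law, ae_withDensity_iff h₀.measurable.ennreal_ofReal]
    exact Eventually.of_forall fun x hx h => hx (by rw [h, ENNReal.ofReal_zero])
  rw [h₀.law_withDensity_ratio h₁,
    Measure.restrict_eq_self_of_ae_mem (s := {x | g₀ x ≠ 0}) (hac.ae_le hne)]

end Density

section OrderStatistics

variable {K : ℕ} {v : Fin K → ℝ}

theorem orderStat_nonneg (hv : ∀ k, 0 ≤ v k) (j : Fin K) : 0 ≤ orderStat v j :=
  hv _

theorem le_orderStat_zero (v : Fin K → ℝ) (k : Fin K) : v k ≤ orderStat v ⟨0, k.pos⟩ := by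
  have hsort := Tuple.monotone_sort (fun i => -v i)
    (show ⟨0, k.pos⟩ ≤ (Tuple.sort fun i => -v i).symm k from Nat.zero_le _)
  simpa [orderStat] using hsort

theorem le_topSum {r : ℕ} (hr : 1 ≤ r) (hv : ∀ k, 0 ≤ v k) (k : Fin K) : v k ≤ topSum r v :=
  (le_orderStat_zero v k).trans <|
    Finset.single_le_sum (f := orderStat v) (fun j _ => orderStat_nonneg hv j)
      (Finset.mem_filter.2 ⟨Finset.mem_univ _, hr⟩)

theorem topSum_le_sum (r : ℕ) (hv : ∀ k, 0 ≤ v k) : topSum r v ≤ ∑ k, v k :=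
  calc topSum r v ≤ ∑ j, orderStat v j :=
        Finset.sum_le_sum_of_subset_of_nonneg (Finset.filter_subset _ _)
          fun j _ _ => orderStat_nonneg hv j
    _ = ∑ k, v k := Equiv.sum_comp (Tuple.sort fun i => -v i) v

end OrderStatistics

section StoppedDrift

variable {Ω : Type*} {mΩ : MeasurableSpace Ω} {P : Measure Ω} {τ : Ω → ℕ∞} {Y : ℕ → Ω → ℝ≥0∞}
  {a c M : ℝ≥0∞}

theorem lintegral_enat_eq_tsum_measure_lt (P : Measure Ω)
    (hτ : ∀ n : ℕ, MeasurableSet {ω | n < τ ω}) :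
    ∫⁻ ω, τ ω ∂P = ∑' n : ℕ, P {ω | n < τ ω} := by
  have hsum (t : ℕ∞) : (t : ℝ≥0∞) = ∑' n : ℕ, if (n : ℕ∞) < t then 1 else 0 := by
    induction t with
    | top => simp
    | coe t =>
      rw [tsum_eq_sum (s := Finset.range t) fun n hn => by simpa using hn]
      simp [Finset.sum_ite_of_true fun _ => Finset.mem_range.1]
  calc ∫⁻ ω, τ ω ∂P = ∫⁻ ω, ∑' n : ℕ, {ω | n < τ ω}.indicator 1 ω ∂P :=
        lintegral_congr fun ω => by simp [hsum, Set.indicator_apply]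
    _ = ∑' n : ℕ, P {ω | n < τ ω} := by
        rw [lintegral_tsum fun n => (measurable_one.indicator (hτ n)).aemeasurable]
        exact tsum_congr fun n => lintegral_indicator_one (hτ n)

theorem lintegral_stoppedProcess (P : Measure Ω) (Y : ℕ → Ω → ℝ≥0∞) {n : ℕ}
    (hτ : MeasurableSet {ω | n < τ ω}) :
    ∫⁻ ω, stoppedProcess Y τ n ω ∂P =
      ∫⁻ ω in {ω | n < τ ω}, Y n ω ∂P + ∫⁻ ω in {ω | n < τ ω}ᶜ, stoppedProcess Y τ n ω ∂P := by
  have hrunning (ω) (hω : ω ∈ {ω | n < τ ω}) : stoppedProcess Y τ n ω = Y n ω :=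
    stoppedProcess_eq_of_le (le_of_lt hω)
  rw [← setLIntegral_congr_fun hτ hrunning, lintegral_add_compl _ hτ]

theorem lintegral_stoppedProcess_succ (P : Measure Ω) (Y : ℕ → Ω → ℝ≥0∞) {n : ℕ}
    (hτ : MeasurableSet {ω | n < τ ω}) :
    ∫⁻ ω, stoppedProcess Y τ (n + 1) ω ∂P =
      ∫⁻ ω in {ω | n < τ ω}, Y (n + 1) ω ∂P +
        ∫⁻ ω in {ω | n < τ ω}ᶜ, stoppedProcess Y τ n ω ∂P := by
  have hfrozen (ω) (hω : ω ∈ {ω | n < τ ω}ᶜ) :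
      stoppedProcess Y τ (n + 1) ω = stoppedProcess Y τ n ω := by
    have hle : τ ω ≤ n := not_lt.1 hω
    rw [stoppedProcess_eq_of_ge hle,
      stoppedProcess_eq_of_ge (hle.trans (Nat.cast_le.2 n.le_succ))]
  have hrunning (ω) (hω : ω ∈ {ω | n < τ ω}) : stoppedProcess Y τ (n + 1) ω = Y (n + 1) ω :=
    stoppedProcess_eq_of_le (Order.add_one_le_of_lt (show (n : ℕ∞) < τ ω from hω))
  rw [← setLIntegral_congr_fun hτ.compl hfrozen, ← setLIntegral_congr_fun hτ hrunning,
    lintegral_add_compl _ hτ]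

theorem lintegral_stoppedProcess_le (hτ : ∀ n : ℕ, MeasurableSet {ω | n < τ ω})
    (hstep : ∀ n : ℕ, ∫⁻ ω in {ω | n < τ ω}, Y (n + 1) ω ∂P ≤
      ∫⁻ ω in {ω | n < τ ω}, Y n ω ∂P + c * P {ω | n < τ ω}) (n : ℕ) :
    ∫⁻ ω, stoppedProcess Y τ n ω ∂P ≤
      ∫⁻ ω, Y 0 ω ∂P + c * ∑ i ∈ Finset.range n, P {ω | i < τ ω} := by
  induction n with
  | zero =>
    have hstart (ω) : stoppedProcess Y τ 0 ω = Y 0 ω := stoppedProcess_eq_of_le bot_le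
    simp only [hstart, Finset.range_zero, Finset.sum_empty, mul_zero, add_zero, le_refl]
  | succ n ih =>
    rw [lintegral_stoppedProcess P Y (hτ n)] at ih
    rw [lintegral_stoppedProcess_succ P Y (hτ n), Finset.sum_range_succ, mul_add, ← add_assoc]
    refine (add_le_add_left (hstep n) _).trans ?_
    rw [add_right_comm]
    exact add_le_add_left ih _

theorem sum_measure_lt_le_lintegral_stoppedProcess
    (hτ : ∀ n : ℕ, MeasurableSet {ω | n < τ ω})
    (hstep : ∀ n : ℕ, ∫⁻ ω in {ω | n < τ ω}, Y n ω ∂P + P {ω | n < τ ω} ≤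
      ∫⁻ ω in {ω | n < τ ω}, Y (n + 1) ω ∂P) (n : ℕ) :
    ∑ i ∈ Finset.range n, P {ω | i < τ ω} ≤ ∫⁻ ω, stoppedProcess Y τ n ω ∂P := by
  induction n with
  | zero => simp
  | succ n ih =>
    rw [lintegral_stoppedProcess P Y (hτ n)] at ih
    rw [lintegral_stoppedProcess_succ P Y (hτ n), Finset.sum_range_succ]
    refine le_trans ?_ (add_le_add_left (hstep n) _)
    rw [add_right_comm]
    exact add_le_add_left ih _

theorem mul_measure_compl_le_lintegral_stoppedProcess
    (hτ : ∀ n : ℕ, MeasurableSet {ω | n < τ ω}) (ha : ∀ (n : ℕ) ω, τ ω = n → a ≤ Y n ω) (n : ℕ) :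
    a * P {ω | n < τ ω}ᶜ ≤ ∫⁻ ω, stoppedProcess Y τ n ω ∂P := by
  rw [← setLIntegral_const]
  refine (setLIntegral_mono' (hτ n).compl fun ω hω => ?_).trans (setLIntegral_le_lintegral _ _)
  have hle : τ ω ≤ n := not_lt.1 hω
  obtain ⟨t, ht⟩ := ENat.ne_top_iff_exists.1 (ne_top_of_le_ne_top (ENat.natCast_ne_top n) hle)
  rw [stoppedProcess_eq_of_ge hle]
  refine ha _ ω ?_
  rw [← ht]
  rfl

theorem le_mul_lintegral_of_drift_le [IsProbabilityMeasure P]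
    (hτ : ∀ n : ℕ, MeasurableSet {ω | n < τ ω}) (hY0 : ∀ ω, Y 0 ω = 0)
    (hstep : ∀ n : ℕ, ∫⁻ ω in {ω | n < τ ω}, Y (n + 1) ω ∂P ≤
      ∫⁻ ω in {ω | n < τ ω}, Y n ω ∂P + c * P {ω | n < τ ω})
    (ha : ∀ (n : ℕ) ω, τ ω = n → a ≤ Y n ω) (ha_top : a ≠ ∞) (hc : c ≠ 0) :
    a ≤ c * ∫⁻ ω, τ ω ∂P := by
  rw [lintegral_enat_eq_tsum_measure_lt P hτ]
  by_cases htop : ∑' n : ℕ, P {ω | n < τ ω} = ∞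
  · rw [htop, ENNReal.mul_top hc]
    exact le_top
  have hle (n : ℕ) : a ≤ c * ∑' n : ℕ, P {ω | n < τ ω} + a * P {ω | n < τ ω} :=
    calc a = a * P {ω | n < τ ω}ᶜ + a * P {ω | n < τ ω} := by
          rw [← mul_add, add_comm, measure_add_measure_compl (hτ n), measure_univ, mul_one]
      _ ≤ c * ∑ i ∈ Finset.range n, P {ω | i < τ ω} + a * P {ω | n < τ ω} := by
          refine add_le_add_left ((mul_measure_compl_le_lintegral_stoppedProcess hτ ha n).trans
            ((lintegral_stoppedProcess_le hτ hstep n).trans ?_)) _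
          simp [hY0]
      _ ≤ _ := by gcongr; exact ENNReal.sum_le_tsum _
  have hlim := ENNReal.Tendsto.const_mul (ENNReal.tendsto_atTop_zero_of_tsum_ne_top htop)
    (Or.inr ha_top)
  simpa using ge_of_tendsto' (hlim.const_add _) hle

theorem lintegral_le_of_one_le_drift [IsProbabilityMeasure P]
    (hτ : ∀ n : ℕ, MeasurableSet {ω | n < τ ω}) (hYM : ∀ n ω, Y n ω ≤ M)
    (hstep : ∀ n : ℕ, ∫⁻ ω in {ω | n < τ ω}, Y n ω ∂P + P {ω | n < τ ω} ≤
      ∫⁻ ω in {ω | n < τ ω}, Y (n + 1) ω ∂P) :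
    ∫⁻ ω, τ ω ∂P ≤ M := by
  rw [lintegral_enat_eq_tsum_measure_lt P hτ]
  refine ENNReal.tsum_le_of_sum_range_le fun n =>
    (sum_measure_lt_le_lintegral_stoppedProcess hτ hstep n).trans ?_
  calc ∫⁻ ω, stoppedProcess Y τ n ω ∂P ≤ ∫⁻ _, M ∂P := lintegral_mono fun ω => hYM _ ω
    _ = M := by rw [lintegral_const, measure_univ, mul_one]

end StoppedDrift

section Independence

theorem setLIntegral_comp_prodMk_of_indep {Ω 𝒳 β : Type*} [MeasurableSpace 𝒳] [MeasurableSpace β]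
    {m' mΩ : MeasurableSpace Ω} {P : Measure Ω} [IsProbabilityMeasure P] (hm' : m' ≤ mΩ)
    {X : Ω → 𝒳} (hX : Measurable X) (hind : Indep (MeasurableSpace.comap X inferInstance) m' P)
    {Y : Ω → β} (hY : Measurable[m'] Y) {E : Set Ω} (hE : MeasurableSet[m'] E)
    {g : β × 𝒳 → ℝ≥0∞} (hg : Measurable g) :
    ∫⁻ ω in E, g (Y ω, X ω) ∂P = ∫⁻ ω in E, ∫⁻ x, g (Y ω, x) ∂P.map X ∂P := by
  have hYm : Measurable Y := hY.mono hm' le_rfl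
  have hprod : ((P.restrict E).map Y).prod (P.map X) =
      (P.restrict E).map fun ω => (Y ω, X ω) := by
    refine Measure.prod_eq fun s t hs ht => ?_
    have hindep := (Indep_iff _ _ P).1 hind _ _ ⟨t, ht, rfl⟩ ((hY hs).inter hE)
    rw [Measure.map_apply (hYm.prodMk hX) (hs.prod ht), Measure.map_apply hYm hs,
      Measure.map_apply hX ht, Measure.restrict_apply ((hYm.prodMk hX) (hs.prod ht)),
      Measure.restrict_apply (hYm hs), mul_comm, ← hindep]
    congr 1
    ext ω
    simp only [Set.mem_inter_iff, Set.mem_preimage, Set.mem_prod]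
    tauto
  rw [← lintegral_map hg (hYm.prodMk hX), ← hprod, lintegral_prod _ hg.aemeasurable,
    lintegral_map hg.lintegral_prod_right' hYm]

end Independence

section HittingTime

variable {K : ℕ} {𝒳 Ω : Type*} {lr : Fin K → 𝒳 → ℝ} {X : Fin K → ℕ → Ω → 𝒳}
  {S : ℕ → Ω → Finset (Fin K)} {r : ℕ} {A : ℝ} {Y : ℕ → Ω → ℝ}

theorem mem_of_hittingAfter_eq {β : Type*} {u : ℕ → Ω → β} {s : Set β} {i n : ℕ} {ω : Ω}
    (h : hittingAfter u s i ω = n) : u n ω ∈ s := by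
  have hmem := hittingAfter_mem_set_of_ne_top (u := u) (s := s) (n := i) (ω := ω)
    (by rw [h]; exact WithTop.coe_ne_top)
  rwa [h] at hmem

theorem hittingAfter_le_T {ω : Ω} (h : ∀ t, topSum r (fun k => R lr X S k t ω) ≤ Y t ω) :
    hittingAfter Y (Set.Ici A) 1 ω ≤ T lr X S r A ω := by
  refine le_sInf ?_
  rintro _ ⟨t, ⟨ht, hA⟩, rfl⟩
  exact hittingAfter_le_of_mem ht (hA.trans (h t))

theorem T_le_hittingAfter {ω : Ω} (h : ∀ t, Y t ω ≤ topSum r fun k => R lr X S k t ω) :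
    T lr X S r A ω ≤ hittingAfter Y (Set.Ici A) 1 ω := by
  rcases eq_or_ne (hittingAfter Y (Set.Ici A) 1 ω) ⊤ with htop | htop
  · rw [htop]
    exact le_top
  · obtain ⟨n, hn⟩ := WithTop.ne_top_iff_exists.1 htop
    obtain ⟨t, ht, hA⟩ := hittingAfter_le_iff.1 hn.ge
    have hT : T lr X S r A ω ≤ (t : ℕ∞) := sInf_le ⟨t, ⟨ht.1, hA.trans (h t)⟩, rfl⟩
    rw [← hn]
    exact hT.trans (Nat.cast_le.2 ht.2)

end HittingTime

section Streams

variable {K : ℕ} {𝒳 Ω : Type*}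

theorem R_nonneg {lr : Fin K → 𝒳 → ℝ} {k : Fin K} (hlr : ∀ x, 0 ≤ lr k x) (X : Fin K → ℕ → Ω → 𝒳)
    (S : ℕ → Ω → Finset (Fin K)) (t : ℕ) (ω : Ω) : 0 ≤ R lr X S k t ω := by
  induction t with
  | zero => exact le_rfl
  | succ t ih =>
    rw [R]
    split_ifs
    · exact mul_nonneg (add_nonneg ih zero_le_one) (hlr _)
    · exact add_nonneg ih zero_le_one

variable [MeasurableSpace 𝒳] {mΩ : MeasurableSpace Ω}

/-- `S` is an arbitrary non-anticipating choice of observed streams, any number of them at a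
time, where each new observation of stream `k` has law `μ k` and is independent of the past. -/
structure IsPredictableSampling (P : Measure Ω) (ℱ : Filtration ℕ mΩ) (μ : Fin K → Measure 𝒳)
    (X : Fin K → ℕ → Ω → 𝒳) (S : ℕ → Ω → Finset (Fin K)) : Prop where
  measurable_obs : ∀ k t, Measurable[ℱ (t + 1)] (X k (t + 1))
  law_obs : ∀ k t, P.map (X k (t + 1)) = μ k
  indep_past : ∀ k t, Indep (MeasurableSpace.comap (X k (t + 1)) inferInstance) (ℱ t) P
  predictable : ∀ t k, MeasurableSet[ℱ t] {ω | k ∈ S (t + 1) ω}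

variable {P : Measure Ω} {ℱ : Filtration ℕ mΩ} {μ : Fin K → Measure 𝒳} {X : Fin K → ℕ → Ω → 𝒳}
  {S : ℕ → Ω → Finset (Fin K)} {lr : Fin K → 𝒳 → ℝ} {k : Fin K} {A : ℝ} {r : ℕ}

theorem IsInControl.isPredictableSampling {G : Fin K → Measure ℝ} {Z : Fin K → ℕ → Ω → ℝ} {q : ℕ}
    (hX : IsInControl P ℱ μ G X Z) (hS : IsLayout ℱ q lr X Z S) :
    IsPredictableSampling P ℱ μ X S where
  measurable_obs := hX.measurable_obs
  law_obs := hX.law_obs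
  predictable := hS.predictable
  indep_past k t := by
    refine indep_of_indep_of_le_left (hX.indep_past t) ?_
    have hproj : Measurable fun p : (Fin K → 𝒳) × (Fin K → ℝ) => p.1 k :=
      (measurable_pi_apply k).comp measurable_fst
    rw [show X k (t + 1) = (fun p : (Fin K → 𝒳) × (Fin K → ℝ) => p.1 k) ∘
      fun ω => (fun k => X k (t + 1) ω, fun k => Z k (t + 1) ω) from rfl,
      ← MeasurableSpace.comap_comp]
    exact MeasurableSpace.comap_mono hproj.comap_le

namespace IsPredictableSampling

theorem adapted_R (h : IsPredictableSampling P ℱ μ X S) (hlr : Measurable (lr k)) :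
    Adapted ℱ (R lr X S k) := by
  intro t
  induction t with
  | zero => exact measurable_const
  | succ t ih =>
    have hR : Measurable[ℱ (t + 1)] (R lr X S k t) := ih.mono (ℱ.mono t.le_succ) le_rfl
    exact Measurable.ite (ℱ.mono t.le_succ _ (h.predictable t k))
      ((hR.add_const 1).mul (hlr.comp (h.measurable_obs k t))) (hR.add_const 1)

-- Given the past, the new observation is averaged out against its law.
theorem setLIntegral_comp_R_succ [IsProbabilityMeasure P] (h : IsPredictableSampling P ℱ μ X S)
    (hlr : Measurable (lr k)) {W : ℝ → ℝ≥0∞} (hW : Measurable W) (t : ℕ) {E : Set Ω}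
    (hE : MeasurableSet[ℱ t] E) :
    ∫⁻ ω in E, W (R lr X S k (t + 1) ω) ∂P =
      ∫⁻ ω in E ∩ {ω | k ∈ S (t + 1) ω}, ∫⁻ x, W ((R lr X S k t ω + 1) * lr k x) ∂μ k ∂P +
        ∫⁻ ω in E \ {ω | k ∈ S (t + 1) ω}, W (R lr X S k t ω + 1) ∂P := by
  have hobs := h.predictable t k
  have hobs' : MeasurableSet {ω | k ∈ S (t + 1) ω} := ℱ.le t _ hobs
  have hEm : MeasurableSet E := ℱ.le t _ hE
  rw [← lintegral_inter_add_sdiff _ E hobs']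
  congr 1
  · have hg : Measurable fun z : ℝ × 𝒳 => W ((z.1 + 1) * lr k z.2) :=
      hW.comp ((measurable_fst.add_const 1).mul (hlr.comp measurable_snd))
    rw [← h.law_obs k t, ← setLIntegral_comp_prodMk_of_indep (ℱ.le t)
      ((h.measurable_obs k t).mono (ℱ.le _) le_rfl) (h.indep_past k t) (h.adapted_R hlr t)
      (hE.inter hobs) hg]
    exact setLIntegral_congr_fun (hEm.inter hobs') fun ω hω => congrArg W (if_pos hω.2)
  · exact setLIntegral_congr_fun (hEm.diff hobs') fun ω hω => congrArg W (if_neg hω.2)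

theorem setLIntegral_R_succ_le [IsProbabilityMeasure P] (h : IsPredictableSampling P ℱ μ X S)
    (hlr : Measurable (lr k)) (hlr0 : ∀ x, 0 ≤ lr k x)
    (hint : ∫⁻ x, ENNReal.ofReal (lr k x) ∂μ k ≤ 1) (t : ℕ) {E : Set Ω}
    (hE : MeasurableSet[ℱ t] E) :
    ∫⁻ ω in E, ENNReal.ofReal (R lr X S k (t + 1) ω) ∂P ≤
      ∫⁻ ω in E, ENNReal.ofReal (R lr X S k t ω) ∂P + P E := by
  have hR0 := R_nonneg hlr0 X S t
  have hobs : MeasurableSet {ω | k ∈ S (t + 1) ω} := ℱ.le t _ (h.predictable t k)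
  have hmean (ω) : ∫⁻ x, ENNReal.ofReal ((R lr X S k t ω + 1) * lr k x) ∂μ k ≤
      ENNReal.ofReal (R lr X S k t ω + 1) := by
    simp only [ENNReal.ofReal_mul (add_nonneg (hR0 ω) zero_le_one)]
    rw [lintegral_const_mul _ hlr.ennreal_ofReal]
    exact mul_le_of_le_one_right' hint
  calc ∫⁻ ω in E, ENNReal.ofReal (R lr X S k (t + 1) ω) ∂P
      ≤ ∫⁻ ω in E ∩ {ω | k ∈ S (t + 1) ω}, ENNReal.ofReal (R lr X S k t ω + 1) ∂P +
        ∫⁻ ω in E \ {ω | k ∈ S (t + 1) ω}, ENNReal.ofReal (R lr X S k t ω + 1) ∂P := by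
        rw [h.setLIntegral_comp_R_succ hlr ENNReal.measurable_ofReal t hE]
        exact add_le_add_left (lintegral_mono hmean) _
    _ = ∫⁻ ω in E, (ENNReal.ofReal (R lr X S k t ω) + 1) ∂P := by
        rw [lintegral_inter_add_sdiff _ _ hobs]
        refine lintegral_congr fun ω => ?_
        rw [ENNReal.ofReal_add (hR0 ω) zero_le_one, ENNReal.ofReal_one]
    _ = _ := by rw [lintegral_add_right _ measurable_const, setLIntegral_one]

theorem add_measure_le_setLIntegral_R_succ [IsProbabilityMeasure P]
    (h : IsPredictableSampling P ℱ μ X S) (hlr : Measurable (lr k)) (hlr0 : ∀ x, 0 ≤ lr k x)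
    {B : ℝ} {M : ℝ≥0∞} {V : ℝ → ℝ≥0∞} (hV : IsPotential (μ k) (lr k) B M V) (t : ℕ) {E : Set Ω}
    (hE : MeasurableSet[ℱ t] E) (hEB : ∀ ω ∈ E, R lr X S k t ω + 1 ≤ B) :
    ∫⁻ ω in E, V (R lr X S k t ω) ∂P + P E ≤ ∫⁻ ω in E, V (R lr X S k (t + 1) ω) ∂P := by
  have hR0 := R_nonneg hlr0 X S t
  have hEm : MeasurableSet E := ℱ.le t _ hE
  have hobs : MeasurableSet {ω | k ∈ S (t + 1) ω} := ℱ.le t _ (h.predictable t k)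
  calc ∫⁻ ω in E, V (R lr X S k t ω) ∂P + P E
      = ∫⁻ ω in E, (V (R lr X S k t ω) + 1) ∂P := by
        rw [lintegral_add_right _ measurable_const, setLIntegral_one]
    _ ≤ ∫⁻ ω in E, V (R lr X S k t ω + 1) ∂P :=
        setLIntegral_mono' hEm fun ω hω => hV.add_one_le _ (hR0 ω) (hEB ω hω)
    _ = ∫⁻ ω in E ∩ {ω | k ∈ S (t + 1) ω}, V (R lr X S k t ω + 1) ∂P +
        ∫⁻ ω in E \ {ω | k ∈ S (t + 1) ω}, V (R lr X S k t ω + 1) ∂P :=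
        (lintegral_inter_add_sdiff _ _ hobs).symm
    _ ≤ _ := by
        rw [h.setLIntegral_comp_R_succ hlr hV.measurable t hE]
        refine add_le_add_left (setLIntegral_mono' (hEm.inter hobs) fun ω hω => ?_) _
        exact hV.le_lintegral _ (by linarith [hR0 ω]) (hEB ω hω.1)

theorem setLIntegral_sum_R_succ_le [IsProbabilityMeasure P] (h : IsPredictableSampling P ℱ μ X S)
    (hlr : ∀ k, Measurable (lr k)) (hlr0 : ∀ k x, 0 ≤ lr k x)
    (hint : ∀ k, ∫⁻ x, ENNReal.ofReal (lr k x) ∂μ k ≤ 1) (t : ℕ) {E : Set Ω}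
    (hE : MeasurableSet[ℱ t] E) :
    ∫⁻ ω in E, ENNReal.ofReal (∑ k, R lr X S k (t + 1) ω) ∂P ≤
      ∫⁻ ω in E, ENNReal.ofReal (∑ k, R lr X S k t ω) ∂P + K * P E := by
  have hsum (t : ℕ) : ∫⁻ ω in E, ENNReal.ofReal (∑ k, R lr X S k t ω) ∂P =
      ∑ k, ∫⁻ ω in E, ENNReal.ofReal (R lr X S k t ω) ∂P := by
    rw [← lintegral_finsetSum _ fun k _ =>
      (((h.adapted_R (hlr k) t).mono (ℱ.le t) le_rfl).ennreal_ofReal)]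
    exact lintegral_congr fun ω =>
      ENNReal.ofReal_sum_of_nonneg fun k _ => R_nonneg (hlr0 k) X S t ω
  calc ∫⁻ ω in E, ENNReal.ofReal (∑ k, R lr X S k (t + 1) ω) ∂P
      ≤ ∑ k, (∫⁻ ω in E, ENNReal.ofReal (R lr X S k t ω) ∂P + P E) := by
        rw [hsum]
        exact Finset.sum_le_sum fun k _ =>
          h.setLIntegral_R_succ_le (hlr k) (hlr0 k) (hint k) t hE
    _ = _ := by
        rw [hsum, Finset.sum_add_distrib, Finset.sum_const, Finset.card_univ, Fintype.card_fin,
          nsmul_eq_mul]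

theorem ofReal_div_le_lintegral_T [IsProbabilityMeasure P] (h : IsPredictableSampling P ℱ μ X S)
    (hlr : ∀ k, Measurable (lr k)) (hlr0 : ∀ k x, 0 ≤ lr k x)
    (hint : ∀ k, ∫⁻ x, ENNReal.ofReal (lr k x) ∂μ k ≤ 1) (hK : 0 < K) (r : ℕ) (A : ℝ) :
    ENNReal.ofReal (A / K) ≤ ∫⁻ ω, (T lr X S r A ω : ℝ≥0∞) ∂P := by
  set Y : ℕ → Ω → ℝ := fun t ω => ∑ k, R lr X S k t ω
  set τ : Ω → ℕ∞ := hittingAfter Y (Set.Ici A) 1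
  have hY : Adapted ℱ Y := fun t => Finset.measurable_sum _ fun k _ => h.adapted_R (hlr k) t
  have hτ (t : ℕ) : MeasurableSet[ℱ t] {ω | t < τ ω} :=
    (hY.isStoppingTime_hittingAfter measurableSet_Ici).measurableSet_gt t
  have hmain : ENNReal.ofReal A ≤ K * ∫⁻ ω, τ ω ∂P :=
    le_mul_lintegral_of_drift_le (Y := fun t ω => ENNReal.ofReal (Y t ω))
      (fun t => ℱ.le t _ (hτ t)) (fun ω => by simp [Y, R])
      (fun t => h.setLIntegral_sum_R_succ_le hlr hlr0 hint t (hτ t))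
      (fun t ω ht => ENNReal.ofReal_le_ofReal (mem_of_hittingAfter_eq ht))
      ENNReal.ofReal_ne_top (Nat.cast_ne_zero.2 hK.ne')
  calc ENNReal.ofReal (A / K) = ENNReal.ofReal A / K := by
        rw [ENNReal.ofReal_div_of_pos (Nat.cast_pos.2 hK), ENNReal.ofReal_natCast]
    _ ≤ ∫⁻ ω, τ ω ∂P := ENNReal.div_le_of_le_mul' hmain
    _ ≤ ∫⁻ ω, (T lr X S r A ω : ℝ≥0∞) ∂P := lintegral_mono fun ω => ENat.toENNReal_le.2 <|
        hittingAfter_le_T fun t => topSum_le_sum r fun k => R_nonneg (hlr0 k) X S t ω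

theorem lintegral_T_le_of_isPotential [IsProbabilityMeasure P]
    (h : IsPredictableSampling P ℱ μ X S) (hlr : Measurable (lr k)) (hlr0 : ∀ k x, 0 ≤ lr k x)
    (hr : 1 ≤ r) (hA : 0 ≤ A) {M : ℝ≥0∞} {V : ℝ → ℝ≥0∞}
    (hV : IsPotential (μ k) (lr k) (A + 1) M V) :
    ∫⁻ ω, (T lr X S r A ω : ℝ≥0∞) ∂P ≤ M := by
  set τ : Ω → ℕ∞ := hittingAfter (R lr X S k) (Set.Ici A) 1
  have hτ (t : ℕ) : MeasurableSet[ℱ t] {ω | t < τ ω} :=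
    ((h.adapted_R hlr).isStoppingTime_hittingAfter measurableSet_Ici).measurableSet_gt t
  have hbelow (t : ℕ) (ω) (hω : t < τ ω) : R lr X S k t ω + 1 ≤ A + 1 := by
    rcases t.eq_zero_or_pos with rfl | ht
    · exact add_le_add_left hA 1
    · have hlt : R lr X S k t ω < A := not_le.1 (notMem_of_lt_hittingAfter hω ht)
      exact add_le_add_left hlt.le 1
  calc ∫⁻ ω, (T lr X S r A ω : ℝ≥0∞) ∂P ≤ ∫⁻ ω, τ ω ∂P :=
        lintegral_mono fun ω => ENat.toENNReal_le.2 <|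
          T_le_hittingAfter fun t => le_topSum hr (fun k => R_nonneg (hlr0 k) X S t ω) k
    _ ≤ M := lintegral_le_of_one_le_drift (fun t => ℱ.le t _ (hτ t)) (fun _ _ => hV.le_bound _)
        fun t => h.add_measure_le_setLIntegral_R_succ hlr (hlr0 k) hV t (hτ t) (hbelow t)

end IsPredictableSampling

end Streams

end TSSRP

theorem theorem2_general {K : ℕ} {𝒳 Ω : Type*} [MeasurableSpace 𝒳] {mΩ : MeasurableSpace Ω}
    (P : Measure Ω) [IsProbabilityMeasure P] (ℱ : Filtration ℕ mΩ) (m : Measure 𝒳)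
    (g₀ g₁ : Fin K → 𝒳 → ℝ) (hg₀ : ∀ k, TSSRP.IsDensity m (g₀ k))
    (hg₁ : ∀ k, TSSRP.IsDensity m (g₁ k)) (X : Fin K → ℕ → Ω → 𝒳) (S : ℕ → Ω → Finset (Fin K))
    (lr : Fin K → 𝒳 → ℝ) (hlr : ∀ k x, lr k x = g₁ k x / g₀ k x)
    (hXS : TSSRP.IsPredictableSampling P ℱ (fun k => TSSRP.law m (g₀ k)) X S)
    (hK : 0 < K) (r : ℕ) (hr : 1 ≤ r) :
    (∀ A : ℝ, ENNReal.ofReal (A / K) ≤ ∫⁻ ω, (TSSRP.T lr X S r A ω : ℝ≥0∞) ∂P) ∧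
    ((∃ k, klDiv (TSSRP.law m (g₁ k)) (TSSRP.law m (g₀ k)) ≠ ∞) →
      ∃ C : ℝ≥0, ∀ᶠ A : ℝ in atTop,
        ∫⁻ ω, (TSSRP.T lr X S r A ω : ℝ≥0∞) ∂P ≤ C * ENNReal.ofReal A) := by
  obtain rfl : lr = fun k x => g₁ k x / g₀ k x := funext₂ hlr
  have hm (k) : Measurable fun x => g₁ k x / g₀ k x := (hg₁ k).measurable.div (hg₀ k).measurable
  have hnonneg (k x) : 0 ≤ g₁ k x / g₀ k x := div_nonneg ((hg₁ k).nonneg x) ((hg₀ k).nonneg x)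
  refine ⟨hXS.ofReal_div_le_lintegral_T hm hnonneg
    (fun k => (hg₀ k).lintegral_ratio_le_one (hg₁ k)) hK r, ?_⟩
  rintro ⟨k, hkl⟩
  have := (hg₀ k).isProbabilityMeasure_law
  have := (hg₁ k).isProbabilityMeasure_law
  obtain ⟨C, hC0, hC⟩ := TSSRP.exists_isPotential_of_klDiv_ne_top (hm k) (hnonneg k)
    ((hg₀ k).law_eq_withDensity_ratio (hg₁ k).measurable (klDiv_ne_top_iff.1 hkl).1) hkl
  refine ⟨(2 * C).toNNReal, (eventually_ge_atTop 1).mono fun A hA => ?_⟩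
  obtain ⟨V, hV⟩ := hC (A + 1) (by linarith)
  calc ∫⁻ ω, (TSSRP.T _ X S r A ω : ℝ≥0∞) ∂P ≤ ENNReal.ofReal (C * (A + 1)) :=
        hXS.lintegral_T_le_of_isPotential (hm k) hnonneg hr (zero_le_one.trans hA) hV
    _ ≤ ENNReal.ofReal (2 * C * A) := ENNReal.ofReal_le_ofReal (by nlinarith)
    _ = (2 * C).toNNReal * ENNReal.ofReal A := ENNReal.ofReal_mul (by positivity)

theorem theorem2 {K : ℕ} {𝒳 Ω Θ : Type*} [MeasurableSpace 𝒳] {mΩ : MeasurableSpace Ω}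
    (P : Measure Ω) [IsProbabilityMeasure P] (ℱ : Filtration ℕ mΩ)
    (m : Measure 𝒳) [SigmaFinite m]
    (f : Θ → 𝒳 → ℝ) (hf : ∀ θ, TSSRP.IsDensity m (f θ)) (θ₀ θ₁ : Fin K → Θ)
    (G : Fin K → Measure ℝ) [∀ k, IsProbabilityMeasure (G k)]
    (X : Fin K → ℕ → Ω → 𝒳) (Z : Fin K → ℕ → Ω → ℝ) (S : ℕ → Ω → Finset (Fin K))
    (lr : Fin K → 𝒳 → ℝ) (hlr : ∀ k x, lr k x = f (θ₁ k) x / f (θ₀ k) x)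
    (hX : TSSRP.IsInControl P ℱ (fun k => TSSRP.law m (f (θ₀ k))) G X Z)
    (q : ℕ) (hS : TSSRP.IsLayout ℱ q lr X Z S)
    (r : ℕ) (hr : 1 ≤ r) (hrK : r ≤ K) :
    (∀ A : ℝ, ENNReal.ofReal (A / K) ≤ ∫⁻ ω, (TSSRP.T lr X S r A ω : ℝ≥0∞) ∂P) ∧
    ((∃ k, klDiv (TSSRP.law m (f (θ₁ k))) (TSSRP.law m (f (θ₀ k))) ≠ ∞) →
      ∃ C : ℝ≥0, ∀ᶠ A : ℝ in atTop,
        ∫⁻ ω, (TSSRP.T lr X S r A ω : ℝ≥0∞) ∂P ≤ C * ENNReal.ofReal A) :=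
  theorem2_general P ℱ m (fun k => f (θ₀ k)) (fun k => f (θ₁ k)) (fun _ => hf _) (fun _ => hf _)
    X S lr hlr (hX.isPredictableSampling hS) (hr.trans hrK) r hr
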